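/- Let $\kappa$ be a strongly inaccessible cardinal (uncountable, regular, and $2^\lambda<\kappa$ for all $\lambda<\kappa$) and let $\mu$ be any cardinal. Call a topological space $\mu$-compact if each of its open covers has a subcover of size less than $\mu$; a GO-space is a space that is (homeomorphic to) a subspace of a linearly ordered set with its order topology; and the Noetherian type of a space $X$ is the least infinite cardinal $\nu$ such that $X$ has a base $\mathcal B$ in which no element is contained in $\nu$-many (or more) elements of $\mathcal B$. Then the following are equivalent: (a) no $\mu$-compact GO-space has Noetherian type $\kappa$; (b) $\mu<\kappa$. -/

import Mathlib

open Cardinal TopologicalSpace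

universe u

/-- A preordered set is `κᵒᵖ`-like if no element is below `κ`-many elements. -/
def IsOpLike (κ : Cardinal.{u}) (P : Type u) [Preorder P] : Prop :=
  ∀ p : P, #{q : P // p ≤ q} < κ

/-- `X` has a base which, ordered by inclusion, is `κᵒᵖ`-like. -/
def HasOpLikeBase (κ : Cardinal.{u}) (X : Type u) [TopologicalSpace X] : Prop :=
  ∃ B : Set (Set X), IsTopologicalBasis B ∧ IsOpLike κ B

/-- The Noetherian type of `X`: the least infinite cardinal `κ` such that `X` has a
`κᵒᵖ`-like base. -/
noncomputable def noetherianType (X : Type u) [TopologicalSpace X] : Cardinal.{u} :=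
  sInf {κ : Cardinal.{u} | ℵ₀ ≤ κ ∧ HasOpLikeBase κ X}

/-- The infimum defining the Noetherian type is attained. -/
theorem noetherianType_spec (X : Type u) [TopologicalSpace X] :
    ℵ₀ ≤ noetherianType X ∧ HasOpLikeBase (noetherianType X) X := by
  have h : {κ : Cardinal.{u} | ℵ₀ ≤ κ ∧ HasOpLikeBase κ X}.Nonempty :=
    ⟨Order.succ (max ℵ₀ #(Set X)), (le_max_left _ _).trans (Order.le_succ _),
      {U : Set X | IsOpen U}, isTopologicalBasis_opens, fun _ =>
        Order.lt_succ_of_le (((mk_subtype_le _).trans (mk_subtype_le _)).trans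
          (le_max_right _ _))⟩
  exact csInf_mem h

/-- `X` is `μ`-compact if every open cover of `X` has a subcover of size less than `μ`. -/
def IsCardCompact (μ : Cardinal.{u}) (X : Type u) [TopologicalSpace X] : Prop :=
  ∀ 𝒰 : Set (Set X), (∀ U ∈ 𝒰, IsOpen U) → ⋃₀ 𝒰 = Set.univ →
    ∃ 𝒱 : Set (Set X), 𝒱 ⊆ 𝒰 ∧ ⋃₀ 𝒱 = Set.univ ∧ #𝒱 < μ

/-- A GO-space (generalized ordered space) is, up to homeomorphism, a subspace of a linearly
ordered set with its order topology. -/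
def IsGOSpace (X : Type u) [TopologicalSpace X] : Prop :=
  ∃ (Y : Type u) (_ : LinearOrder Y) (_ : TopologicalSpace Y) (_ : OrderTopology Y)
    (f : X → Y), Topology.IsEmbedding f

/-- The class of Noetherian types of `μ`-compact GO-spaces. -/
def noetherianSpectrumGO (μ : Cardinal.{u}) : Set Cardinal.{u} :=
  {c | ∃ (X : Type u) (_ : TopologicalSpace X),
    IsGOSpace X ∧ IsCardCompact μ X ∧ noetherianType X = c}

/-! ### Closing a set under an operation on small subsets -/

section Cardinals

open Set

/-! Let `μ < κ` and let a `μ`-compact GO-space have a `κᵒᵖ`-like base. Inaccessibility yields a set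
`A` of size `< κ` closed under witnesses for cuts: those made by its subsets of size `< μ`, and
those made by base elements that contain an interval between points of `A`. Each such interval
contains a base element, so fewer than `κ` cuts arise from it. Such an `A` is dense
(`dense_of_captures`): a point outside its closure would have nearest neighbours in `A` on both
sides, with no point of `A` between. A regular space with a dense set of size `< κ` has a base of
size `< κ`, hence smaller Noetherian type.

If `κ ≤ μ`, the successor ordinals below `κ` together with a top point form an example. Regularity
of `κ` suffices here. -/

theorem Cardinal.IsRegular.exists_forall_lt_of_mk_lt {κ : Cardinal.{u}} (hκ : κ.IsRegular)
    {S : Set κ.ord.ToType} (hS : #S < κ) : ∃ i, ∀ s ∈ S, s < i := by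
  have h : ¬ IsCofinal S := fun h => by
    have := Order.cof_le h
    rw [Ordinal.cof_toType, hκ.cof_ord] at this
    exact this.not_gt hS
  simpa [IsCofinal] using h

theorem Cardinal.IsRegular.mk_union_lt {κ : Cardinal.{u}} (hκ : κ.IsRegular) {α : Type u}
    {s t : Set α} (hs : #s < κ) (ht : #t < κ) : #(s ∪ t : Set α) < κ :=
  (mk_union_le s t).trans_lt (add_lt_of_lt hκ.aleph0_le hs ht)

theorem Cardinal.IsRegular.mk_biUnion_lt {κ : Cardinal.{u}} (hκ : κ.IsRegular) {α β : Type u}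
    {s : Set α} {t : α → Set β} (hs : #s < κ) (ht : ∀ a ∈ s, #(t a) < κ) :
    #(⋃ a ∈ s, t a : Set β) < κ :=
  (card_biUnion_lt_iff_forall_of_isRegular hκ hs).2 ht

/-- The stages of the closure of the empty set under `F` applied to subsets of size `< μ`. -/
def closureStage {ι α : Type u} [LinearOrder ι] [WellFoundedLT ι] (μ : Cardinal.{u})
    (F : Set α → Set α) (i : ι) : Set α :=
  ⋃ j : Iio i, ⋃ C ∈ {C : Set α | C ⊆ closureStage μ F j.1 ∧ #C < μ}, F C
termination_by wellFounded_lt.wrap i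
decreasing_by exact j.2

theorem mem_closureStage {ι α : Type u} [LinearOrder ι] [WellFoundedLT ι] {μ : Cardinal.{u}}
    {F : Set α → Set α} {i : ι} {x : α} :
    x ∈ closureStage μ F i ↔ ∃ j < i, ∃ C ⊆ closureStage μ F j, #C < μ ∧ x ∈ F C := by
  rw [closureStage]
  simp only [mem_iUnion, mem_ofPred_eq, exists_prop, Subtype.exists, mem_Iio]
  exact ⟨fun ⟨j, hj, C, h, hx⟩ => ⟨j, hj, C, h.1, h.2, hx⟩,
    fun ⟨j, hj, C, h, h', hx⟩ => ⟨j, hj, C, ⟨h, h'⟩, hx⟩⟩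

theorem closureStage_mono {ι α : Type u} [LinearOrder ι] [WellFoundedLT ι] (μ : Cardinal.{u})
    (F : Set α → Set α) : Monotone (closureStage μ F : ι → Set α) := by
  intro i j hij x hx
  obtain ⟨k, hk, h⟩ := mem_closureStage.1 hx
  exact mem_closureStage.2 ⟨k, hk.trans_le hij, h⟩

theorem mk_closureStage_lt {ι α : Type u} [LinearOrder ι] [WellFoundedLT ι] {κ μ : Cardinal.{u}}
    (hκ : κ.IsInaccessible) (hι : #ι < κ) {F : Set α → Set α}
    (hF : ∀ C : Set α, #C < μ → #(F C) < κ) (i : ι) : #(closureStage μ F i) < κ := by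
  induction i using WellFoundedLT.induction with
  | ind i ih =>
    rw [closureStage]
    refine (card_iUnion_lt_iff_forall_of_isRegular hκ.isRegular
      ((mk_subtype_le _).trans_lt hι)).2 fun j => ?_
    refine hκ.isRegular.mk_biUnion_lt ?_ fun C hC => hF C hC.2
    refine (mk_le_mk_of_subset (t := 𝒫 (closureStage μ F j.1)) fun C hC => hC.1).trans_lt ?_
    rw [mk_powerset]
    exact hκ.isStrongPrelimit (ih j.1 j.2)

theorem exists_closed_under {α : Type u} {κ μ : Cardinal.{u}} (hκ : κ.IsInaccessible)
    (hμ : μ < κ) {F : Set α → Set α} (hF : ∀ C : Set α, #C < μ → #(F C) < κ) :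
    ∃ A : Set α, #A < κ ∧ ∀ C ⊆ A, #C < μ → F C ⊆ A := by
  -- `μ` may be finite or singular; a regular length above `μ` ensures that every subset of size `<
  -- μ` already lies in one stage.
  set c := Order.succ (max μ ℵ₀) with hc
  have hreg : c.IsRegular := isRegular_succ (le_max_right _ _)
  have hcκ : c < κ := hκ.isSuccLimit.succ_lt (max_lt hμ hκ.aleph0_lt)
  have hμc : μ < c := (le_max_left _ _).trans_lt (Order.lt_succ _)
  have hcard : #c.ord.ToType < κ := by rwa [mk_ord_toType]
  refine ⟨⋃ i : c.ord.ToType, closureStage μ F i,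
    (card_iUnion_lt_iff_forall_of_isRegular hκ.isRegular hcard).2
      fun i => mk_closureStage_lt hκ hcard hF i, fun C hCA hC x hx => ?_⟩
  choose f hf using fun y : C => mem_iUnion.1 (hCA y.2)
  obtain ⟨i, hi⟩ := hreg.exists_forall_lt_of_mk_lt (S := range f)
    (mk_range_le.trans_lt (hC.trans hμc))
  have := noMaxOrder hreg.aleph0_le
  obtain ⟨j, hj⟩ := exists_gt i
  refine mem_iUnion.2 ⟨j, mem_closureStage.2 ⟨i, hj, C, fun y hy => ?_, hC, hx⟩⟩
  exact closureStage_mono μ F (hi _ ⟨⟨y, hy⟩, rfl⟩).le (hf ⟨y, hy⟩)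

end Cardinals

/-! ### A small dense set from a `κᵒᵖ`-like base -/

section Density

open Set Topology

/-- `A` meets the final segment of strict upper bounds of `S` coinitially, or contains the
greatest element of `S`. -/
def CapturesAbove {X : Type u} [LinearOrder X] (A S : Set X) : Prop :=
  ∀ x, (∀ s ∈ S, s < x) → ∃ t ∈ A, ((∀ s ∈ S, s < t) ∧ t ≤ x) ∨ IsGreatest S t

theorem CapturesAbove.mono {X : Type u} [LinearOrder X] {A A' S : Set X}
    (h : CapturesAbove A S) (hA : A ⊆ A') : CapturesAbove A' S := fun x hx =>
  let ⟨t, ht, h'⟩ := h x hx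
  ⟨t, hA ht, h'⟩

/-- The topology has arbitrarily small order convex neighbourhoods. -/
def HasConvexNhds (X : Type u) [LinearOrder X] [TopologicalSpace X] : Prop :=
  ∀ a : X, ∀ U ∈ 𝓝 a, ∃ W ∈ 𝓝 a, ∀ x ∈ W, ∀ y ∈ W, Icc x y ⊆ U

theorem HasConvexNhds.dual {X : Type u} [LinearOrder X] [TopologicalSpace X]
    (h : HasConvexNhds X) : HasConvexNhds Xᵒᵈ := by
  intro a U hU
  obtain ⟨W, hW, hWU⟩ := h (OrderDual.ofDual a) U hU
  exact ⟨W, hW, fun x hx y hy z hz => hWU y hy x hx ⟨hz.2, hz.1⟩⟩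

variable {X : Type u} [LinearOrder X] [TopologicalSpace X] [OrderClosedTopology X]

theorem isOpen_lowerClosure_of_no_max {S : Set X} (hS : ∀ s ∈ S, ∃ s' ∈ S, s < s') :
    IsOpen {y : X | ∃ s ∈ S, y ≤ s} := by
  have : {y : X | ∃ s ∈ S, y ≤ s} = ⋃ s ∈ S, Iio s := by
    ext y
    simp only [mem_ofPred_eq, mem_iUnion, mem_Iio, exists_prop]
    constructor
    · rintro ⟨s, hs, hy⟩
      obtain ⟨s', hs', h⟩ := hS s hs
      exact ⟨s', hs', hy.trans_lt h⟩
    · rintro ⟨s, hs, hy⟩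
      exact ⟨s, hs, hy.le⟩
  rw [this]
  exact isOpen_biUnion fun s _ => isOpen_Iio

theorem exists_small_cofinal {μ : Cardinal.{u}} (hX : IsCardCompact μ X) {S : Set X}
    (hS : ∀ s ∈ S, ∃ s' ∈ S, s < s') (hE : IsOpen {y : X | ∀ s ∈ S, s < y}) :
    ∃ C ⊆ S, #C < μ ∧ ∀ s ∈ S, ∃ c ∈ C, s < c := by
  obtain ⟨𝒱, h𝒱, hcov, hcard⟩ := hX (insert {y : X | ∀ s ∈ S, s < y} (Iio '' S))
    (by
      rintro U (rfl | ⟨s, -, rfl⟩)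
      exacts [hE, isOpen_Iio])
    (by
      refine eq_univ_of_forall fun y => ?_
      by_cases hy : ∀ s ∈ S, s < y
      · exact ⟨_, mem_insert _ _, hy⟩
      · push Not at hy
        obtain ⟨s, hs, hys⟩ := hy
        obtain ⟨s', hs', h⟩ := hS s hs
        exact ⟨_, mem_insert_of_mem _ ⟨s', hs', rfl⟩, hys.trans_lt h⟩)
  refine ⟨S ∩ Iio ⁻¹' 𝒱, inter_subset_left, ?_, fun s hs => ?_⟩
  · exact (mk_le_mk_of_subset inter_subset_right).trans_lt
      ((mk_preimage_of_injective _ _ Iio_injective).trans_lt hcard)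
  · obtain ⟨V, hV, hsV⟩ : s ∈ ⋃₀ 𝒱 := hcov ▸ mem_univ s
    rcases h𝒱 hV with rfl | ⟨c, hc, rfl⟩
    · exact absurd (hsV s hs) (lt_irrefl s)
    · exact ⟨c, ⟨hc, hV⟩, hsV⟩

/-- One point suffices unless the cut above `S` is a gap. At a gap both sides are open, and
compactness gives a small coinitial set above. -/
theorem exists_capturesAbove {μ κ : Cardinal.{u}} (hμ : μ < κ) (hκ : 1 < κ)
    (hX : IsCardCompact μ X) (S : Set X) : ∃ T : Set X, #T < κ ∧ CapturesAbove T S := by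
  by_cases hmax : ∃ d, IsGreatest S d
  · obtain ⟨d, hd⟩ := hmax
    exact ⟨{d}, by simpa using hκ, fun x _ => ⟨d, rfl, Or.inr hd⟩⟩
  have hS : ∀ s ∈ S, ∃ s' ∈ S, s < s' := by
    intro s hs
    by_contra! h
    exact hmax ⟨s, hs, h⟩
  set E : Set X := {y : X | ∀ s ∈ S, s < y} with hE
  by_cases hmin : ∃ e, IsLeast E e
  · obtain ⟨e, he⟩ := hmin
    exact ⟨{e}, by simpa using hκ, fun x hx => ⟨e, rfl, Or.inl ⟨he.1, he.2 hx⟩⟩⟩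
  have hE' : ∀ e ∈ E, ∃ e' ∈ E, e' < e := by
    intro e he
    by_contra! h
    exact hmin ⟨e, he, h⟩
  have hopen : IsOpen {y : X | ∀ e ∈ E, y < e} := by
    convert isOpen_lowerClosure_of_no_max hS using 1
    ext y
    constructor
    · intro hy
      by_contra! h
      simp only [mem_ofPred_eq, not_exists, not_and, not_le] at h
      exact lt_irrefl y (hy y h)
    · rintro ⟨s, hs, hys⟩ e he
      exact hys.trans_lt (he s hs)
  obtain ⟨C, hCE, hC, hcof⟩ := exists_small_cofinal (X := Xᵒᵈ) (S := E) hX hE' hopen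
  refine ⟨C, hC.trans hμ, fun x hx => ?_⟩
  obtain ⟨c, hc, hcx⟩ := hcof x hx
  exact ⟨c, hc, Or.inl ⟨hCE hc, le_of_lt hcx⟩⟩

/-- Without a maximum, `A ∩ Iio x` either has a small cofinal subset, contradicting `hsmall`, or
converges to some `a < x`. In the latter case a base element around `a` inside `Iio x` contradicts
`hbase`. -/
theorem exists_isGreatest_inter_Iio {μ : Cardinal.{u}} (hX : IsCardCompact μ X)
    (hconv : HasConvexNhds X) {B : Set (Set X)} (hB : IsTopologicalBasis B) {A : Set X}
    (hsmall : ∀ C ⊆ A, #C < μ → CapturesAbove A C)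
    (hbase : ∀ U ∈ B, ∀ a ∈ A, ∀ b ∈ A, (Ioo a b).Nonempty → Ioo a b ⊆ U → CapturesAbove A U)
    {x : X} (hx : x ∉ closure A) : ∃ a, IsGreatest (A ∩ Iio x) a := by
  by_contra hmax
  set S := A ∩ Iio x with hSdef
  have hxA : x ∉ A := fun h => hx (subset_closure h)
  have hS : ∀ s ∈ S, ∃ s' ∈ S, s < s' := by
    intro s hs
    by_contra! h
    exact hmax ⟨s, hs, h⟩
  have hmemS : ∀ t ∈ A, t ≤ x → t ∈ S := fun t ht htx =>
    ⟨ht, lt_of_le_of_ne htx fun h => hxA (h ▸ ht)⟩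
  set E : Set X := {y : X | ∀ s ∈ S, s < y} with hE
  have hxE : x ∈ E := fun s hs => hs.2
  by_cases hopen : IsOpen E
  · obtain ⟨C, hCS, hC, hcof⟩ := exists_small_cofinal hX hS hopen
    obtain ⟨t, htA, ⟨ht, htx⟩ | ht⟩ :=
      hsmall C (hCS.trans inter_subset_left) hC x fun c hc => (hCS hc).2
    · obtain ⟨c, hc, htc⟩ := hcof t (hmemS t htA htx)
      exact lt_asymm htc (ht c hc)
    · obtain ⟨c, hc, htc⟩ := hcof t (hCS ht.1)
      exact (ht.2 hc).not_gt htc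
  -- `E` is not open, so it has a least element `a`, which is a limit of `S`.
  obtain ⟨a, haE, ha⟩ : ∃ a ∈ E, E ∉ 𝓝 a := by
    simpa [isOpen_iff_mem_nhds] using hopen
  have hleast : ∀ e ∈ E, a ≤ e := by
    intro e he
    by_contra! h
    exact ha (Filter.mem_of_superset (Ioi_mem_nhds h) fun y hy s hs => (he s hs).trans hy)
  have hlim : ∀ U ∈ 𝓝 a, ∃ s ∈ S, ∃ s' ∈ S, (Ioo s s').Nonempty ∧ Icc s s' ⊆ U := by
    intro U hU
    obtain ⟨W, hW, hWU⟩ := hconv a U hU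
    have haW := mem_of_mem_nhds hW
    obtain ⟨y, hyW, hyE⟩ : ∃ y ∈ W, y ∉ E := by
      by_contra! h
      exact ha (Filter.mem_of_superset hW h)
    simp only [hE, mem_ofPred_eq, not_forall, not_lt] at hyE
    obtain ⟨s, hs, hys⟩ := hyE
    obtain ⟨s', hs', hss'⟩ := hS s hs
    obtain ⟨s'', hs'', hss''⟩ := hS s' hs'
    exact ⟨s, hs, s'', hs'', ⟨s', hss', hss''⟩, fun z hz =>
      hWU y hyW a haW ⟨hys.trans hz.1, hz.2.trans (haE s'' hs'').le⟩⟩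
  have hax : a < x := by
    refine lt_of_le_of_ne (hleast x hxE) ?_
    rintro rfl
    refine hx (mem_closure_iff_nhds.2 fun U hU => ?_)
    obtain ⟨s, hs, s', -, ⟨z, hz⟩, hU⟩ := hlim U hU
    exact ⟨s, hU ⟨le_rfl, (hz.1.trans hz.2).le⟩, hs.1⟩
  obtain ⟨U, hUB, haU, hUx⟩ := hB.mem_nhds_iff.1 (Iio_mem_nhds hax)
  obtain ⟨s, hs, s', hs', hss', hsU⟩ := hlim U (hB.mem_nhds hUB haU)
  obtain ⟨t, htA, ⟨ht, htx⟩ | ht⟩ := hbase U hUB s hs.1 s' hs'.1 hss'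
    (Ioo_subset_Icc_self.trans hsU) x fun u hu => hUx hu
  · exact lt_asymm (ht a haU) (haE t (hmemS t htA htx))
  · exact (ht.2 haU).not_gt (haE t (hmemS t htA (le_of_lt (hUx ht.1))))

theorem dense_of_captures {μ : Cardinal.{u}} (hX : IsCardCompact μ X)
    (hconv : HasConvexNhds X) {B : Set (Set X)} (hB : IsTopologicalBasis B) {A : Set X}
    (hsmall : ∀ C ⊆ A, #C < μ → CapturesAbove A C ∧ CapturesAbove (X := Xᵒᵈ) A C)
    (hbase : ∀ U ∈ B, ∀ a ∈ A, ∀ b ∈ A, (Ioo a b).Nonempty → Ioo a b ⊆ U →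
      CapturesAbove A U ∧ CapturesAbove (X := Xᵒᵈ) A U)
    (hbetween : ∀ a ∈ A, ∀ b ∈ A, (Ioo a b).Nonempty → (A ∩ Ioo a b).Nonempty) :
    Dense A := by
  intro x
  by_contra hx
  obtain ⟨a, ha⟩ := exists_isGreatest_inter_Iio hX hconv hB (fun C hC h => (hsmall C hC h).1)
    (fun U hU a ha b hb h h' => (hbase U hU a ha b hb h h').1) hx
  obtain ⟨b, hb⟩ : ∃ b, IsLeast (A ∩ Ioi x) b :=
    exists_isGreatest_inter_Iio (X := Xᵒᵈ) hX hconv.dual hB (fun C hC h => (hsmall C hC h).2)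
      (fun U hU a ha b hb ⟨z, hz⟩ h' => (hbase U hU b hb a ha ⟨z, hz.2, hz.1⟩
        fun z hz => h' ⟨hz.2, hz.1⟩).2) hx
  obtain ⟨y, hyA, hay, hyb⟩ := hbetween a ha.1.1 b hb.1.1 ⟨x, ha.1.2, hb.1.2⟩
  rcases lt_trichotomy y x with h | rfl | h
  · exact (ha.2 ⟨hyA, h⟩).not_gt hay
  · exact hx (subset_closure hyA)
  · exact (hb.2 ⟨hyA, h⟩).not_gt hyb

/-- A `μ`-compact GO-space with a `κᵒᵖ`-like base, `μ < κ` inaccessible, has density `< κ`. -/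
theorem exists_dense_mk_lt {κ μ : Cardinal.{u}} (hκ : κ.IsInaccessible) (hμ : μ < κ)
    (hX : IsCardCompact μ X) (hconv : HasConvexNhds X) (hB : HasOpLikeBase κ X) :
    ∃ A : Set X, #A < κ ∧ Dense A := by
  obtain ⟨B, hB, hop⟩ := hB
  have hreg := hκ.isRegular
  have h1 : 1 < κ := one_lt_aleph0.trans hκ.aleph0_lt
  choose T hTcard hT using exists_capturesAbove (X := X) hμ h1 hX
  choose T' hT'card hT' using exists_capturesAbove (X := Xᵒᵈ) hμ h1 hX
  have hV : ∀ a b : X, ∃ p : X, ∃ V ∈ B, (Ioo a b).Nonempty → p ∈ Ioo a b ∧ V ⊆ Ioo a b := by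
    intro a b
    by_cases h : (Ioo a b).Nonempty
    · obtain ⟨p, hp⟩ := h
      obtain ⟨V, hVB, -, hV⟩ := hB.mem_nhds_iff.1 (isOpen_Ioo.mem_nhds hp)
      exact ⟨p, V, hVB, fun _ => ⟨hp, hV⟩⟩
    · obtain ⟨V, hVB, -⟩ := hB.mem_nhds_iff.1 (Filter.univ_mem (f := 𝓝 a))
      exact ⟨a, V, hVB, fun h' => absurd h' h⟩
  choose p V hVB hpV using hV
  -- The union has fewer than `κ` terms because the base is `κᵒᵖ`-like at `V a b`.
  set H : X → X → Set X := fun a b =>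
    {p a b} ∪ ⋃ U ∈ {U : Set X | U ∈ B ∧ V a b ⊆ U}, (T U ∪ T' U) with hH
  have hHcard : ∀ a b, #(H a b) < κ := by
    intro a b
    refine hreg.mk_union_lt (by simpa using h1) (hreg.mk_biUnion_lt ?_ fun U _ =>
      hreg.mk_union_lt (hTcard U) (hT'card U))
    refine lt_of_le_of_lt ?_ (hop ⟨V a b, hVB a b⟩)
    exact mk_le_of_injective (f := fun U => ⟨⟨U.1, U.2.1⟩, U.2.2⟩) fun U U' h => by
      simpa [Subtype.ext_iff] using h
  -- The maximum with `ℵ₀` makes pairs count as small even if `μ` is finite.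
  obtain ⟨A, hA, hcl⟩ := exists_closed_under (α := X) hκ (max_lt hμ hκ.aleph0_lt)
    (F := fun C => T C ∪ T' C ∪ ⋃ a ∈ C, ⋃ b ∈ C, H a b) fun C hC => by
      have hC' : #C < κ := hC.trans (max_lt hμ hκ.aleph0_lt)
      exact hreg.mk_union_lt (hreg.mk_union_lt (hTcard C) (hT'card C))
        (hreg.mk_biUnion_lt hC' fun a _ => hreg.mk_biUnion_lt hC' fun b _ => hHcard a b)
  have hHA : ∀ a ∈ A, ∀ b ∈ A, H a b ⊆ A := by
    intro a ha b hb
    refine Subset.trans ?_ (hcl {a, b} (by simp [insert_subset_iff, ha, hb])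
      ((lt_aleph0_of_finite _).trans_le (le_max_right _ _)))
    refine Subset.trans ?_ subset_union_right
    intro x hx
    simp only [mem_iUnion]
    exact ⟨a, by simp, b, by simp, hx⟩
  refine ⟨A, hA, dense_of_captures hX hconv hB (fun C hCA hC => ?_)
    (fun U hUB a ha b hb hne hU => ?_) fun a ha b hb hne => ?_⟩
  · have := hcl C hCA (hC.trans_le (le_max_left _ _))
    exact ⟨(hT C).mono ((subset_union_left.trans subset_union_left).trans this),
      (hT' C).mono ((subset_union_right.trans subset_union_left).trans this)⟩
  · have : T U ∪ T' U ⊆ A := by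
      refine Subset.trans ?_ (hHA a ha b hb)
      exact (subset_biUnion_of_mem (u := fun U => T U ∪ T' U)
        (show U ∈ {U : Set X | U ∈ B ∧ V a b ⊆ U} from
          ⟨hUB, (hpV a b hne).2.trans hU⟩)).trans subset_union_right
    exact ⟨(hT U).mono (subset_union_left.trans this),
      (hT' U).mono (subset_union_right.trans this)⟩
  · exact ⟨p a b, hHA a ha b hb (Or.inl rfl), (hpV a b hne).1⟩

end Density

/-! ### From density to Noetherian type -/

section Weight

open Set Topology

theorem Dense.exists_isTopologicalBasis_mk_le {X : Type u} [TopologicalSpace X] [RegularSpace X]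
    {A : Set X} (hA : Dense A) : ∃ B : Set (Set X), IsTopologicalBasis B ∧ #B ≤ 2 ^ #A := by
  refine ⟨(fun E => interior (closure E)) '' 𝒫 A, ?_, mk_image_le.trans (mk_powerset A).le⟩
  refine isTopologicalBasis_of_isOpen_of_nhds ?_ fun x U hx hU => ?_
  · rintro _ ⟨E, -, rfl⟩
    exact isOpen_interior
  · obtain ⟨K, hK, hKc, hKU⟩ := exists_mem_nhds_isClosed_subset (hU.mem_nhds hx)
    refine ⟨_, ⟨interior K ∩ A, inter_subset_right, rfl⟩, ?_, ?_⟩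
    · exact interior_maximal (hA.open_subset_closure_inter isOpen_interior) isOpen_interior
        (mem_interior_iff_mem_nhds.2 hK)
    · refine interior_subset.trans ((closure_minimal ?_ hKc).trans hKU)
      exact inter_subset_left.trans interior_subset

theorem noetherianType_le {X : Type u} [TopologicalSpace X] {κ : Cardinal.{u}} (hκ : ℵ₀ ≤ κ)
    (h : HasOpLikeBase κ X) : noetherianType X ≤ κ :=
  csInf_le' ⟨hκ, h⟩

theorem noetherianType_lt_of_dense {X : Type u} [TopologicalSpace X] [RegularSpace X]
    {κ : Cardinal.{u}} (hκ : κ.IsInaccessible) {A : Set X} (hA : Dense A) (hcard : #A < κ) :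
    noetherianType X < κ := by
  obtain ⟨B, hB, hBcard⟩ := hA.exists_isTopologicalBasis_mk_le
  refine (noetherianType_le (κ := Order.succ (max (2 ^ #A) ℵ₀))
    ((le_max_right _ _).trans (Order.le_succ _)) ⟨B, hB, fun p => ?_⟩).trans_lt
      (hκ.isSuccLimit.succ_lt (max_lt (hκ.isStrongPrelimit hcard) hκ.aleph0_lt))
  exact Order.lt_succ_of_le ((mk_subtype_le _).trans (hBcard.trans (le_max_left _ _)))

theorem IsGOSpace.regularSpace {X : Type u} [TopologicalSpace X] (hX : IsGOSpace X) :
    RegularSpace X := by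
  obtain ⟨Y, _, _, _, f, hf⟩ := hX
  exact hf.t3Space.toRegularSpace

theorem IsGOSpace.exists_linearOrder {X : Type u} [TopologicalSpace X] (hX : IsGOSpace X) :
    ∃ _ : LinearOrder X, OrderClosedTopology X ∧ HasConvexNhds X := by
  obtain ⟨Y, _, _, _, f, hf⟩ := hX
  let := LinearOrder.lift' f hf.injective
  have hmono : ∀ a b : X, a ≤ b ↔ f a ≤ f b := fun _ _ => Iff.rfl
  refine ⟨this, ⟨?_⟩, fun a U hU => ?_⟩
  · exact isClosed_le (f := fun p : X × X => f p.1) (g := fun p => f p.2)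
      (hf.continuous.comp continuous_fst) (hf.continuous.comp continuous_snd)
  · rw [hf.nhds_eq_comap] at hU ⊢
    obtain ⟨V, hV, hVU⟩ := hU
    have ht : Filter.Tendsto (fun p : Y × Y => Icc p.1 p.2) (𝓝 (f a) ×ˢ 𝓝 (f a))
        (𝓝 (f a)).smallSets := Filter.tendsto_fst.Icc Filter.tendsto_snd
    obtain ⟨W, hW, hWV⟩ := Filter.mem_prod_self_iff.1
      (Filter.tendsto_smallSets_iff.1 ht V hV)
    exact ⟨f ⁻¹' W, Filter.preimage_mem_comap hW, fun x hx y hy z hz =>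
      hVU (hWV (mk_mem_prod hx hy) ⟨hz.1, hz.2⟩)⟩

theorem IsGOSpace.noetherianType_ne {X : Type u} [TopologicalSpace X] (hX : IsGOSpace X)
    {κ μ : Cardinal.{u}} (hκ : κ.IsInaccessible) (hμ : μ < κ) (hc : IsCardCompact μ X) :
    noetherianType X ≠ κ := by
  intro h
  obtain ⟨_, _, hconv⟩ := hX.exists_linearOrder
  have := hX.regularSpace
  obtain ⟨A, hA, hd⟩ := exists_dense_mk_lt hκ hμ hc hconv (h ▸ (noetherianType_spec X).2)
  exact (noetherianType_lt_of_dense hκ hd hA).ne h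

end Weight

/-! ### A space of Noetherian type `κ` when `κ ≤ μ` -/

section Example

open Set Topology

/-- The successors of `W` together with a point at infinity, inside `W` with a top adjoined. -/
abbrev SuccTop (W : Type u) [LinearOrder W] [SuccOrder W] : Type u :=
  {y : WithTop W // y = ⊤ ∨ ∃ w : W, y = (Order.succ w : W)}

namespace SuccTop

variable {W : Type u} [LinearOrder W] [SuccOrder W]

/-- The point at infinity. -/
def top : SuccTop W := ⟨⊤, Or.inl rfl⟩

/-- The point of `SuccTop W` given by the successor of `w`. -/
def succ (w : W) : SuccTop W := ⟨(Order.succ w : W), Or.inr ⟨w, rfl⟩⟩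

/-- The basic neighbourhood of the point at infinity given by `w`. -/
def tail (w : W) : Set (SuccTop W) := {x | (w : WithTop W) < x.1}

instance : TopologicalSpace (SuccTop W) :=
  TopologicalSpace.induced Subtype.val (Preorder.topology (WithTop W))

theorem isGOSpace : IsGOSpace (SuccTop W) := by
  let := Preorder.topology (WithTop W)
  exact ⟨WithTop W, inferInstance, inferInstance, ⟨rfl⟩, Subtype.val,
    ⟨⟨rfl⟩, Subtype.val_injective⟩⟩

theorem eq_top_or (x : SuccTop W) : x = top ∨ ∃ w, x = succ w := by
  obtain ⟨x, rfl | ⟨w, rfl⟩⟩ := x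
  exacts [Or.inl rfl, Or.inr ⟨w, rfl⟩]

theorem top_mem_tail (w : W) : top ∈ tail w := WithTop.coe_lt_top w

theorem isOpen_tail (w : W) : IsOpen (tail w) := by
  let := Preorder.topology (WithTop W)
  have : OrderTopology (WithTop W) := ⟨rfl⟩
  exact isOpen_induced (isOpen_Ioi (a := (w : WithTop W)))

theorem tail_subset_tail {v w : W} (h : v ≤ w) : tail w ⊆ tail v := fun _ hx =>
  (WithTop.coe_le_coe.2 h).trans_lt hx

theorem succ_ne_top (w : W) : succ w ≠ top := by
  simp [succ, top]

theorem exists_tail_subset [Nonempty W] {U : Set (SuccTop W)} (hU : IsOpen U) (h : top ∈ U) :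
    ∃ w, tail w ⊆ U := by
  let := Preorder.topology (WithTop W)
  have : OrderTopology (WithTop W) := ⟨rfl⟩
  obtain ⟨V, hV, rfl⟩ := isOpen_induced_iff.1 hU
  obtain ⟨l, hl, hlV⟩ := exists_Ioc_subset_of_mem_nhds (hV.mem_nhds h)
    ⟨((Classical.arbitrary W : W) : WithTop W), WithTop.coe_lt_top _⟩
  lift l to W using hl.ne
  exact ⟨l, fun x hx => hlV ⟨hx, le_top⟩⟩

theorem exists_tail_subset_sInter [Nonempty W] {𝒮 : Set (Set (SuccTop W))}
    (h𝒮 : ∀ U ∈ 𝒮, IsOpen U ∧ top ∈ U)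
    (hW : ∀ f : 𝒮 → W, ∃ w, ∀ U, f U < w) : ∃ w, tail w ⊆ ⋂₀ 𝒮 := by
  choose f hf using fun U : 𝒮 => exists_tail_subset (h𝒮 U U.2).1 (h𝒮 U U.2).2
  obtain ⟨w, hw⟩ := hW f
  exact ⟨w, subset_sInter fun U hU => (tail_subset_tail (hw ⟨U, hU⟩).le).trans (hf ⟨U, hU⟩)⟩

variable [NoMaxOrder W]

theorem succ_mem_tail {v w : W} : succ v ∈ tail w ↔ w ≤ v := by
  simp [succ, tail, Order.lt_succ_iff]

theorem succ_injective : Function.Injective (succ : W → SuccTop W) := fun v w h => by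
  simpa [succ] using h

theorem isOpen_singleton_succ (w : W) : IsOpen {succ w} := by
  let := Preorder.topology (WithTop W)
  have : OrderTopology (WithTop W) := ⟨rfl⟩
  have h : ({succ w} : Set (SuccTop W)) =
      Subtype.val ⁻¹' Ioo (w : WithTop W) (Order.succ (Order.succ w) : W) := by
    ext x
    rw [mem_singleton_iff, mem_preimage, mem_Ioo]
    rcases eq_top_or x with rfl | ⟨v, rfl⟩
    · simp [(succ_ne_top w).symm]
      simp [top]
    · rw [succ_injective.eq_iff]
      simp [succ, Order.lt_succ_iff, le_antisymm_iff, and_comm]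
  rw [h]
  exact isOpen_induced isOpen_Ioo

variable {κ : Cardinal.{u}}

theorem isCardCompact [Nonempty W] {μ : Cardinal.{u}} (hκ : κ.IsRegular)
    (hIio : ∀ w : W, #(Iio w) < κ) (hμ : κ ≤ μ) : IsCardCompact μ (SuccTop W) := by
  intro 𝒰 hopen hcov
  choose g hg𝒰 hg using fun x : SuccTop W => (hcov ▸ mem_univ x : x ∈ ⋃₀ 𝒰)
  obtain ⟨w, hw⟩ := exists_tail_subset (hopen _ (hg𝒰 top)) (hg top)
  refine ⟨insert (g top) ((fun v => g (succ v)) '' Iio w), ?_, ?_, ?_⟩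
  · rintro _ (rfl | ⟨v, -, rfl⟩)
    exacts [hg𝒰 _, hg𝒰 _]
  · refine eq_univ_of_forall fun x => ?_
    rcases eq_top_or x with rfl | ⟨v, rfl⟩
    · exact ⟨_, mem_insert _ _, hg top⟩
    · rcases lt_or_ge v w with h | h
      · exact ⟨_, mem_insert_of_mem _ ⟨v, h, rfl⟩, hg _⟩
      · exact ⟨_, mem_insert _ _, hw (succ_mem_tail.2 h)⟩
  · refine lt_of_lt_of_le ?_ hμ
    exact mk_insert_le.trans_lt (add_lt_of_lt hκ.aleph0_le (mk_image_le.trans_lt (hIio w))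
      (one_lt_aleph0.trans_le hκ.aleph0_le))

theorem hasOpLikeBase [Nonempty W] (hκ : κ.IsRegular) (hIio : ∀ w : W, #(Iio w) < κ) :
    HasOpLikeBase κ (SuccTop W) := by
  refine ⟨range (fun w => {succ w}) ∪ range tail,
    isTopologicalBasis_of_isOpen_of_nhds ?_ fun x U hx hU => ?_, fun p => ?_⟩
  · rintro _ (⟨w, rfl⟩ | ⟨w, rfl⟩)
    exacts [isOpen_singleton_succ w, isOpen_tail w]
  · rcases eq_top_or x with rfl | ⟨w, rfl⟩
    · obtain ⟨w, hw⟩ := exists_tail_subset hU hx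
      exact ⟨tail w, Or.inr ⟨w, rfl⟩, top_mem_tail w, hw⟩
    · exact ⟨{succ w}, Or.inl ⟨w, rfl⟩, rfl, singleton_subset_iff.2 hx⟩
  · obtain ⟨w, hw⟩ : ∃ w, succ w ∈ p.1 := by
      obtain ⟨_, ⟨w, rfl⟩ | ⟨w, rfl⟩⟩ := p
      exacts [⟨w, rfl⟩, ⟨w, succ_mem_tail.2 le_rfl⟩]
    have hsub : (Subtype.val ∘ Subtype.val) '' (univ : Set {q // p ≤ q}) ⊆
        insert {succ w} (tail '' Iio (Order.succ w)) := by
      rintro _ ⟨⟨⟨_, ⟨v, rfl⟩ | ⟨v, rfl⟩⟩, hq⟩, -, rfl⟩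
      · have : succ w = succ v := hq hw
        exact Or.inl (by simp [this])
      · exact Or.inr ⟨v, Order.lt_succ_iff.2 (succ_mem_tail.1 (hq hw)), rfl⟩
    rw [← mk_univ, ← mk_image_eq (Subtype.val_injective.comp Subtype.val_injective)]
    refine (mk_le_mk_of_subset hsub).trans_lt (mk_insert_le.trans_lt (add_lt_of_lt hκ.aleph0_le
      (mk_image_le.trans_lt (hIio _)) (one_lt_aleph0.trans_le hκ.aleph0_le)))

/-- Fewer than `κ` neighbourhoods of the top share a tail, hence an isolated point. If `ν < κ`, then
`ν` base elements at the top would all contain the base element at that point. -/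
theorem le_of_hasOpLikeBase [Nonempty W]
    (hW : ∀ S : Set W, #S < κ → ∃ w, ∀ s ∈ S, s < w) {ν : Cardinal.{u}}
    (h : HasOpLikeBase ν (SuccTop W)) : κ ≤ ν := by
  obtain ⟨B, hB, hop⟩ := h
  have key : ∀ 𝒮 ⊆ {U ∈ B | top ∈ U}, #𝒮 < κ → ∃ w : W, tail w ⊆ ⋂₀ 𝒮 := fun 𝒮 h𝒮 hcard =>
    exists_tail_subset_sInter (fun U hU => ⟨hB.isOpen (h𝒮 hU).1, (h𝒮 hU).2⟩) fun f =>
      let ⟨w, hw⟩ := hW (range f) (mk_range_le.trans_lt hcard)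
      ⟨w, fun U => hw _ ⟨U, rfl⟩⟩
  have hcard : κ ≤ #{U ∈ B | top ∈ U} := by
    by_contra! hlt
    obtain ⟨w, hw⟩ := key _ subset_rfl hlt
    obtain ⟨U, hUB, hU, hUw⟩ := hB.mem_nhds_iff.1
      ((isOpen_tail (Order.succ w)).mem_nhds (top_mem_tail _))
    -- A common tail of all base elements at the top would lie in every smaller tail.
    have : succ w ∈ tail (Order.succ w) :=
      hUw (hw (succ_mem_tail.2 le_rfl) U ⟨hUB, hU⟩)
    exact (Order.lt_succ w).not_ge (succ_mem_tail.1 this)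
  by_contra! hν
  obtain ⟨𝒮, h𝒮, rfl⟩ := le_mk_iff_exists_subset.1 (hν.le.trans hcard)
  obtain ⟨w, hw⟩ := key 𝒮 h𝒮 hν
  obtain ⟨V, hVB, hV, hVw⟩ := hB.mem_nhds_iff.1 ((isOpen_singleton_succ w).mem_nhds rfl)
  refine (hop ⟨V, hVB⟩).not_ge (mk_le_of_injective
    (f := fun U : 𝒮 => ⟨⟨U.1, (h𝒮 U.2).1⟩, fun x hx => ?_⟩) fun U U' h => ?_)
  · rw [hVw hx]
    exact hw (succ_mem_tail.2 le_rfl) U U.2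
  · simpa [Subtype.ext_iff] using h

end SuccTop

theorem Cardinal.IsRegular.mem_noetherianSpectrumGO {κ μ : Cardinal.{u}} (hκ : κ.IsRegular)
    (hμ : κ ≤ μ) : κ ∈ noetherianSpectrumGO μ := by
  have := noMaxOrder hκ.aleph0_le
  have : Nonempty κ.ord.ToType := by
    rw [← mk_ne_zero_iff, mk_ord_toType]
    exact hκ.ne_zero
  have hIio : ∀ w : κ.ord.ToType, #(Iio w) < κ := fun w => by
    simpa using mk_Iio_lt w (by simp)
  refine ⟨SuccTop κ.ord.ToType, inferInstance, SuccTop.isGOSpace,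
    SuccTop.isCardCompact hκ hIio hμ, le_antisymm
      (noetherianType_le hκ.aleph0_le (SuccTop.hasOpLikeBase hκ hIio))
      (SuccTop.le_of_hasOpLikeBase (fun S hS => hκ.exists_forall_lt_of_mk_lt hS)
        (noetherianType_spec _).2)⟩

end Example

theorem mainTheorem10 (κ μ : Cardinal.{u}) (hκ : Cardinal.IsInaccessible κ) :
    κ ∉ noetherianSpectrumGO μ ↔ μ < κ := by
  constructor
  · intro h
    by_contra! hμ
    exact h (hκ.isRegular.mem_noetherianSpectrumGO hμ)
  · rintro hμ ⟨X, _, hX, hc, h⟩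
    exact hX.noetherianType_ne hκ hμ hc h
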